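/- **Setting.** Let $\mathcal S,\widehat{\mathcal S}_1,\widehat{\mathcal S}_2$ be finite sets, $S$ a random variable on $\mathcal S$ with law $P_S$, $M_1,M_2\ge 1$ integers, $\mathcal X_i=\mathcal Y_i=\{1,\dots,M_i\}$, $d_i:\mathcal S\times\widehat{\mathcal S}_i\to[0,\infty)$ distortion measures and $D_i\in[0,\infty)$, $i=1,2$. All channels are noiseless: $P_{Y_i|X_i}(y_i|x_i)=\mathbb I\{y_i=x_i\}$. A successive refinement code consists of encoders $f_i:\mathcal S\to\mathcal X_i$ and decoders $g_1:\mathcal Y_1\to\widehat{\mathcal S}_1$, $g_2:\mathcal Y_1\times\mathcal Y_2\to\widehat{\mathcal S}_2$, with $X_i=f_i(S)$, $\widehat S_1=g_1(Y_1)$, $\widehat S_2=g_2(Y_1,Y_2)$; a randomized code has kernels $Q_{X_1|S},Q_{X_2|S},Q_{\widehat S_1|Y_1},Q_{\widehat S_2|Y_1Y_2}$ instead, and the joint law $P_SQ_{X_1|S}Q_{X_2|S}P_{Y_1|X_1}P_{Y_2|X_2}Q_{\widehat S_1|Y_1}Q_{\widehat S_2|Y_1Y_2}$. Logarithms are natural.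 Let $R^{(i)}(D)=\inf\{I(S;\widehat S_i): P_{\widehat S_i|S},\ \mathbb E[d_i(S,\widehat S_i)]\le D\}$. Assume that this infimum is attained at $D=D_i$, fix an optimal kernel with output law $P_{\widehat S_i^*}$, and assume that $R^{(i)}$ is differentiable at $D_i$; put $\lambda_i^*=-R^{(i)\prime}(D_i)$ and $$j_{\widehat S_i}(s,D_i)=\log\frac1{\mathbb E[\exp(\lambda_i^*D_i-\lambda_i^*d_i(s,\widehat S_i^*))]} .$$ Assume that $(S,D_1,D_2)$ is successively refinable: the set of pairs $(R_1,R_2)\in[0,\infty)^2$ for which there is a kernel $P_{\widehat S_1\widehat S_2|S}$ with $\mathbb E[d_i(S,\widehat S_i)]\le D_i$ $(i=1,2)$, $I(S;\widehat S_1)\le R_1$ and $I(S;\widehat S_1,\widehat S_2)\le R_1+R_2$, equals $\{(R_1,R_2)\in[0,\infty)^2: R_1\ge R^{(1)}(D_1),\ R_1+R_2\ge R^{(2)}(D_2)\}$. **The program DPSR** (the dual of a lift-and-project linear programming relaxation of the coding problem). Put $\Pi=P_S(s)\,\mathbb I\{y_1=x_1\}\mathbb I\{y_2=x_2\}\mathbb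 I\{d_1(s,\widehat s_1)>D_1\text{ or }d_2(s,\widehat s_2)>D_2\}$. Over all real-valued functions $\eta^1(s)$, $\eta^2(y_1)$, $\eta^3(y_1,y_2)$, $\eta^4(s)$, $\lambda^a(s,x_2,y_1,y_2,\widehat s_1,\widehat s_2)$, $\lambda^b(s,x_1,y_1,y_2,\widehat s_1,\widehat s_2)$, $\lambda^c(s,x_1,x_2,y_1,y_2,\widehat s_1)$, $\mu(s,x_1,x_2,y_1)$, $\delta^1(x_2,s)$, $\delta^2(s,\widehat s_2,y_1,y_2)$, $\delta^3(s,\widehat s_1,y_1)$, $\theta(x_1,s,y_1,\widehat s_2,y_2)$, $\gamma(x_2,s,\widehat s_1,y_1,y_2)$, maximize $$\sum_s\eta^1(s)+\sum_{y_1}\eta^2(y_1)+\sum_{y_1,y_2}\eta^3(y_1,y_2)$$ subject, for all values of the free indices, to $\eta^1\le\delta^1$; $\eta^2\le\sum_s\delta^3$; $\eta^3\le\sum_s\delta^2$; $\lambda^a+\lambda^b+\lambda^c\le\Pi$; $\mu\le\sum_{y_2}\lambda^c$; $\delta^1\le\sum_{y_1}\mu$; $\delta^2\le\theta$; $\delta^3\le\sum_{y_2}\gamma$;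 $\theta\le\lambda^b$; $\gamma\le\lambda^a$; $\eta^4\le0$. Let $\mathrm{OPT}(\mathrm{DPSR})$ be the supremum of the objective. **Theorem.** For every code, deterministic or randomized, $$\mathbb P[d_1(S,\widehat S_1)>D_1\text{ or }d_2(S,\widehat S_2)>D_2]\ \ge\ \mathrm{OPT}(\mathrm{DPSR})\ \ge\ \sup_{\gamma_1,\gamma_2\in\mathbb R}\bigl\{B(\gamma_1,\gamma_2)+\Delta(\gamma_1,\gamma_2)\bigr\},$$ where $$B(\gamma_1,\gamma_2)=\mathbb P\bigl[j_{\widehat S_1}(S,D_1)\ge\log M_1+\gamma_1\text{ or }j_{\widehat S_2}(S,D_2)\ge\log (M_1M_2)+\gamma_2\bigr]-e^{-\gamma_1}-e^{-\gamma_2},$$ $$\Delta(\gamma_1,\gamma_2)=\sum_s\frac{P_S(s)}{2M_1}\Bigl(e^{j_{\widehat S_1}(s,D_1)-\gamma_1}+\frac1{M_2}e^{j_{\widehat S_2}(s,D_2)-\gamma_2}\Bigr)\mathbb I\bigl\{j_{\widehat S_1}(s,D_1)<\log M_1+\gamma_1,\ j_{\widehat S_2}(s,D_2)<\log (M_1M_2)+\gamma_2\bigr\}.$$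 Moreover, for all $\gamma_1,\gamma_2\in\mathbb R$ there is a feasible point of DPSR with objective value $B(\gamma_1,\gamma_2)+\Delta(\gamma_1,\gamma_2)$, and $\Delta(\gamma_1,\gamma_2)\ge0$, so that the bound is at least as large as $\sup_{\gamma_1,\gamma_2}B(\gamma_1,\gamma_2)$, the bound of Zhou et al. -/

import Mathlib

/-! # Finite-alphabet rate-distortion theory

A law on a finite alphabet `S` is a point of `stdSimplex ℝ S`; logarithms are natural. -/

namespace SuccRef

/-- `W` is a conditional distribution (stochastic kernel) from `A` to `B`; `W a b` is `W(b|a)`. -/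
def IsKernel {A B : Type*} [Fintype B] (W : A → B → ℝ) : Prop :=
  ∀ a, W a ∈ stdSimplex ℝ B

/-- The output marginal `∑ a, P(a) W(b|a)`. -/
noncomputable def outputLaw {A B : Type*} [Fintype A] (P : A → ℝ) (W : A → B → ℝ) (b : B) : ℝ :=
  ∑ a, P a * W a b

/-- Mutual information `I(A;B)` (in nats) under the joint law `P(a) W(b|a)`.  If the output law
vanishes at `b`, all the weights `P(a) W(b|a)` vanish, so such terms contribute `0`. -/
noncomputable def mutualInfo {A B : Type*} [Fintype A] [Fintype B]
    (P : A → ℝ) (W : A → B → ℝ) : ℝ :=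
  ∑ a, ∑ b, P a * W a b * Real.log (W a b / outputLaw P W b)

/-- The expected distortion `E[d(A,B)]` under the joint law `P(a) W(b|a)`. -/
noncomputable def expDistortion {A B : Type*} [Fintype A] [Fintype B]
    (P : A → ℝ) (d : A → B → ℝ) (W : A → B → ℝ) : ℝ :=
  ∑ a, ∑ b, P a * W a b * d a b

/-- The rate-distortion function
`R(D) = inf { I(S;T) : P_{T|S} a kernel with E[d(S,T)] ≤ D }`. -/
noncomputable def rateDistortion {S T : Type*} [Fintype S] [Fintype T]
    (P : S → ℝ) (d : S → T → ℝ) (D : ℝ) : ℝ :=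
  sInf {r | ∃ W : S → T → ℝ, IsKernel W ∧ expDistortion P d W ≤ D ∧ r = mutualInfo P W}

/-- `W` achieves the infimum in the rate-distortion function at the level `D`
(in particular the level `D` is feasible). -/
def IsOptimalTestChannel {S T : Type*} [Fintype S] [Fintype T]
    (P : S → ℝ) (d : S → T → ℝ) (D : ℝ) (W : S → T → ℝ) : Prop :=
  IsKernel W ∧ expDistortion P d W ≤ D ∧ mutualInfo P W = rateDistortion P d D

/-- The `D`-tilted information
`log (1 / E[exp (λ D - λ d(s,T*))])`, where `λ = - R'(D)` and `T*` has the output law of `W`;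
used with a `W` that achieves the infimum in `R(D)` and with `R` differentiable at `D`.
(The real-valued `rateDistortion` is `0` at infeasible levels; so it is differentiable at the least
feasible level only if `R` vanishes there and hence at every feasible level, and then `λ = 0`.) -/
noncomputable def tiltedInfo {S T : Type*} [Fintype S] [Fintype T]
    (P : S → ℝ) (d : S → T → ℝ) (D : ℝ) (W : S → T → ℝ) (s : S) : ℝ :=
  Real.log (1 / ∑ t, outputLaw P W t *
    Real.exp (-deriv (rateDistortion P d) D * D - -deriv (rateDistortion P d) D * d s t))

/-- The successive refinement rate region: nonnegative pairs `(R₁, R₂)` such that some kernel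
`P_{T₁ T₂ | S}` meets both distortion constraints and has `I(S;T₁) ≤ R₁`,
`I(S;T₁,T₂) ≤ R₁ + R₂`. -/
def rateRegion {S T₁ T₂ : Type*} [Fintype S] [Fintype T₁] [Fintype T₂]
    (P : S → ℝ) (d₁ : S → T₁ → ℝ) (d₂ : S → T₂ → ℝ) (D₁ D₂ : ℝ) : Set (ℝ × ℝ) :=
  {r | 0 ≤ r.1 ∧ 0 ≤ r.2 ∧ ∃ W : S → T₁ × T₂ → ℝ, IsKernel W ∧
    expDistortion P (fun s t => d₁ s t.1) W ≤ D₁ ∧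
    expDistortion P (fun s t => d₂ s t.2) W ≤ D₂ ∧
    mutualInfo P (fun s t₁ => ∑ t₂, W s (t₁, t₂)) ≤ r.1 ∧
    mutualInfo P W ≤ r.1 + r.2}

/-- Successive refinability at `(D₁, D₂)`: the rate region is limited only by the two individual
rate-distortion functions, `R₁ ≥ R⁽¹⁾(D₁)` and `R₁ + R₂ ≥ R⁽²⁾(D₂)`. -/
def IsSuccessivelyRefinable {S T₁ T₂ : Type*} [Fintype S] [Fintype T₁] [Fintype T₂]
    (P : S → ℝ) (d₁ : S → T₁ → ℝ) (d₂ : S → T₂ → ℝ) (D₁ D₂ : ℝ) : Prop :=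
  rateRegion P d₁ d₂ D₁ D₂ =
    {r | 0 ≤ r.1 ∧ 0 ≤ r.2 ∧ rateDistortion P d₁ D₁ ≤ r.1 ∧ rateDistortion P d₂ D₂ ≤ r.1 + r.2}

/-! ## Codes -/

/-- The noiseless channel `P_{Y|X}(y|x) = 1{y = x}`. -/
def noiseless {M : ℕ} (y x : Fin M) : ℝ := if y = x then 1 else 0

/-- The joint excess distortion loss `1{d₁(s,t₁) > D₁ or d₂(s,t₂) > D₂}`. -/
noncomputable def excessLoss {S T₁ T₂ : Type*} (d₁ : S → T₁ → ℝ) (d₂ : S → T₂ → ℝ) (D₁ D₂ : ℝ)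
    (s : S) (t₁ : T₁) (t₂ : T₂) : ℝ :=
  if D₁ < d₁ s t₁ ∨ D₂ < d₂ s t₂ then 1 else 0

/-- A deterministic code: two encoders of the source and two decoders, the first seeing only the
first message and the second seeing both. -/
structure Code (S T₁ T₂ : Type*) (M₁ M₂ : ℕ) where
  f₁ : S → Fin M₁
  f₂ : S → Fin M₂
  g₁ : Fin M₁ → T₁
  g₂ : Fin M₁ → Fin M₂ → T₂

/-- The joint excess distortion probability of a deterministic code over noiseless channels. -/
noncomputable def Code.excessProb {S T₁ T₂ : Type*} [Fintype S] {M₁ M₂ : ℕ}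
    (c : Code S T₁ T₂ M₁ M₂) (P : S → ℝ) (d₁ : S → T₁ → ℝ) (d₂ : S → T₂ → ℝ) (D₁ D₂ : ℝ) : ℝ :=
  ∑ s, P s * excessLoss d₁ d₂ D₁ D₂ s (c.g₁ (c.f₁ s)) (c.g₂ (c.f₁ s) (c.f₂ s))

/-- A randomized code: the encoders and decoders are kernels. -/
structure RandCode (S T₁ T₂ : Type*) [Fintype T₁] [Fintype T₂] (M₁ M₂ : ℕ) where
  qX₁ : S → Fin M₁ → ℝ
  qX₂ : S → Fin M₂ → ℝ
  qT₁ : Fin M₁ → T₁ → ℝ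
  qT₂ : Fin M₁ × Fin M₂ → T₂ → ℝ
  qX₁_kernel : IsKernel qX₁
  qX₂_kernel : IsKernel qX₂
  qT₁_kernel : IsKernel qT₁
  qT₂_kernel : IsKernel qT₂

/-- The joint excess distortion probability `∑_z κ(z) Q(z)` of a randomized code, where
`Q = P_S Q_{X₁|S} Q_{X₂|S} P_{Y₁|X₁} P_{Y₂|X₂} Q_{T₁|Y₁} Q_{T₂|Y₁Y₂}`. -/
noncomputable def RandCode.excessProb {S T₁ T₂ : Type*} [Fintype S] [Fintype T₁] [Fintype T₂]
    {M₁ M₂ : ℕ} (c : RandCode S T₁ T₂ M₁ M₂)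
    (P : S → ℝ) (d₁ : S → T₁ → ℝ) (d₂ : S → T₂ → ℝ) (D₁ D₂ : ℝ) : ℝ :=
  ∑ s, ∑ x₁, ∑ x₂, ∑ y₁, ∑ y₂, ∑ t₁, ∑ t₂,
    excessLoss d₁ d₂ D₁ D₂ s t₁ t₂ *
      (P s * c.qX₁ s x₁ * c.qX₂ s x₂ * noiseless y₁ x₁ * noiseless y₂ x₂ *
        c.qT₁ y₁ t₁ * c.qT₂ (y₁, y₂) t₂)

/-! ## The dual linear program -/

/-- The variables of the dual program, all real and unrestricted in sign. -/
structure DualVars (S T₁ T₂ : Type*) (M₁ M₂ : ℕ) where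
  η₁ : S → ℝ
  η₂ : Fin M₁ → ℝ
  η₃ : Fin M₁ → Fin M₂ → ℝ
  η₄ : S → ℝ
  /-- `lamA s x₂ y₁ y₂ t₁ t₂` -/
  lamA : S → Fin M₂ → Fin M₁ → Fin M₂ → T₁ → T₂ → ℝ
  /-- `lamB s x₁ y₁ y₂ t₁ t₂` -/
  lamB : S → Fin M₁ → Fin M₁ → Fin M₂ → T₁ → T₂ → ℝ
  /-- `lamC s x₁ x₂ y₁ y₂ t₁` -/
  lamC : S → Fin M₁ → Fin M₂ → Fin M₁ → Fin M₂ → T₁ → ℝ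
  /-- `μ s x₁ x₂ y₁` -/
  μ : S → Fin M₁ → Fin M₂ → Fin M₁ → ℝ
  /-- `δ₁ x₂ s` -/
  δ₁ : Fin M₂ → S → ℝ
  /-- `δ₂ s t₂ y₁ y₂` -/
  δ₂ : S → T₂ → Fin M₁ → Fin M₂ → ℝ
  /-- `δ₃ s t₁ y₁` -/
  δ₃ : S → T₁ → Fin M₁ → ℝ
  /-- `θ x₁ s y₁ t₂ y₂` -/
  θ : Fin M₁ → S → Fin M₁ → T₂ → Fin M₂ → ℝ
  /-- `γ x₂ s t₁ y₁ y₂` -/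
  γ : Fin M₂ → S → T₁ → Fin M₁ → Fin M₂ → ℝ

/-- The dual objective. -/
noncomputable def DualVars.objective {S T₁ T₂ : Type*} [Fintype S] {M₁ M₂ : ℕ}
    (F : DualVars S T₁ T₂ M₁ M₂) : ℝ :=
  (∑ s, F.η₁ s) + (∑ y₁, F.η₂ y₁) + (∑ y₁, ∑ y₂, F.η₃ y₁ y₂)

/-- The constraints of the dual program.  Each of them belongs to one family of variables of the
primal linear program. -/
structure DualVars.Feasible {S T₁ T₂ : Type*} [Fintype S] {M₁ M₂ : ℕ}
    (F : DualVars S T₁ T₂ M₁ M₂)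
    (P : S → ℝ) (d₁ : S → T₁ → ℝ) (d₂ : S → T₂ → ℝ) (D₁ D₂ : ℝ) : Prop where
  c1 : ∀ s x₂, F.η₁ s - F.δ₁ x₂ s ≤ 0
  c2 : ∀ y₁ t₁, F.η₂ y₁ - ∑ s, F.δ₃ s t₁ y₁ ≤ 0
  c3 : ∀ y₁ y₂ t₂, F.η₃ y₁ y₂ - ∑ s, F.δ₂ s t₂ y₁ y₂ ≤ 0
  c4 : ∀ s x₁ x₂ y₁ y₂ t₁ t₂,
    F.lamA s x₂ y₁ y₂ t₁ t₂ + F.lamB s x₁ y₁ y₂ t₁ t₂ + F.lamC s x₁ x₂ y₁ y₂ t₁ ≤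
      P s * noiseless y₁ x₁ * noiseless y₂ x₂ * excessLoss d₁ d₂ D₁ D₂ s t₁ t₂
  c5 : ∀ s x₁ x₂ y₁ t₁, -(∑ y₂, F.lamC s x₁ x₂ y₁ y₂ t₁) + F.μ s x₁ x₂ y₁ ≤ 0
  c6 : ∀ s x₁ x₂, -(∑ y₁, F.μ s x₁ x₂ y₁) + F.δ₁ x₂ s ≤ 0
  c7 : ∀ s x₁ y₁ y₂ t₂, -F.θ x₁ s y₁ t₂ y₂ + F.δ₂ s t₂ y₁ y₂ ≤ 0
  c8 : ∀ s x₂ y₁ t₁, -(∑ y₂, F.γ x₂ s t₁ y₁ y₂) + F.δ₃ s t₁ y₁ ≤ 0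
  c9 : ∀ s x₁ y₁ y₂ t₁ t₂, -F.lamB s x₁ y₁ y₂ t₁ t₂ + F.θ x₁ s y₁ t₂ y₂ ≤ 0
  c10 : ∀ s x₂ y₁ y₂ t₁ t₂, -F.lamA s x₂ y₁ y₂ t₁ t₂ + F.γ x₂ s t₁ y₁ y₂ ≤ 0
  c11 : ∀ s, F.η₄ s ≤ 0

/-- The optimal value of the dual program, as a supremum in the extended reals. -/
noncomputable def optDPSR {S T₁ T₂ : Type*} [Fintype S] (M₁ M₂ : ℕ)
    (P : S → ℝ) (d₁ : S → T₁ → ℝ) (d₂ : S → T₂ → ℝ) (D₁ D₂ : ℝ) : EReal :=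
  ⨆ (F : DualVars S T₁ T₂ M₁ M₂) (_ : F.Feasible P d₁ d₂ D₁ D₂), ((F.objective : ℝ) : EReal)

/-! ## The bound

Here `j₁ j₂ : S → ℝ` are the two tilted informations. -/

/-- The tilted-information converse
`P[j₁ ≥ log M₁ + γ₁ or j₂ ≥ log (M₁ M₂) + γ₂] - exp(-γ₁) - exp(-γ₂)`. -/
noncomputable def baseBound {S : Type*} [Fintype S] (M₁ M₂ : ℕ) (P j₁ j₂ : S → ℝ)
    (γ₁ γ₂ : ℝ) : ℝ :=
  (∑ s, if Real.log M₁ + γ₁ ≤ j₁ s ∨ Real.log (M₁ * M₂) + γ₂ ≤ j₂ s then P s else 0)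
    - Real.exp (-γ₁) - Real.exp (-γ₂)

/-- The additional term
`∑ s, P(s)/(2 M₁) (exp (j₁(s) - γ₁) + exp (j₂(s) - γ₂) / M₂)
  1{j₁(s) < log M₁ + γ₁, j₂(s) < log (M₁ M₂) + γ₂}`. -/
noncomputable def improvement {S : Type*} [Fintype S] (M₁ M₂ : ℕ) (P j₁ j₂ : S → ℝ)
    (γ₁ γ₂ : ℝ) : ℝ :=
  ∑ s, P s / (2 * M₁) *
    ((Real.exp (j₁ s - γ₁) + 1 / M₂ * Real.exp (j₂ s - γ₂)) *
      if j₁ s < Real.log M₁ + γ₁ ∧ j₂ s < Real.log (M₁ * M₂) + γ₂ then 1 else 0)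

end SuccRef

/-!
Mixing the optimal kernel with a competitor bounds every mutual information below by the tangent of
the rate-distortion function at `D`. So the optimal kernel solves the Lagrangian problem, and its
output law maximizes `∑ P(s) log ∑ Q(t) exp (λ D - λ d(s,t))` over all laws `Q`. Since `λ ≥ 0`, the
Kuhn-Tucker conditions of this maximum give `∑ P(s) exp (j(s,D)) 1{d(s,t) ≤ D} ≤ 1` for each `t`.

For weak duality it suffices to consider deterministic codes, because drawing each encoder and
decoder output from a kernel is never better than its best deterministic choice. A dual point
arises from the weights `a(s) = exp (j₁(s) - γ₁) / M₁` and `b(s) = exp (j₂(s) - γ₂) / (M₁ M₂)`: by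
the inequality above they cost `exp (-γ₁) / M₁` for each `y₁` and `exp (-γ₂) / (M₁ M₂)` for each
`(y₁, y₂)`, and in return `s` may be credited any `v(s) ≤ min 1 (a(s) + b(s))`. Taking the average
of `a(s)` and `b(s)` where both are less than `1` produces the additional term.
-/

namespace SuccRef

section RealInequalities

theorem sum_mul_log_sum_div_sum_le {ι : Type*} (s : Finset ι) {x y : ι → ℝ}
    (hx : ∀ i ∈ s, 0 ≤ x i) (hy : ∀ i ∈ s, 0 ≤ y i) (hxy : ∀ i ∈ s, y i = 0 → x i = 0) :
    (∑ i ∈ s, x i) * Real.log ((∑ i ∈ s, x i) / ∑ i ∈ s, y i) ≤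
      ∑ i ∈ s, x i * Real.log (x i / y i) := by
  rcases (Finset.sum_nonneg hy).eq_or_lt with hY | hY
  · have hx0 : ∀ i ∈ s, x i = 0 := fun i hi =>
      hxy i hi ((Finset.sum_eq_zero_iff_of_nonneg hy).1 hY.symm i hi)
    rw [Finset.sum_eq_zero hx0, zero_mul,
      Finset.sum_eq_zero fun i hi => by rw [hx0 i hi, zero_mul]]
  set Y := ∑ i ∈ s, y i
  have jensen := Real.convexOn_mul_log.map_sum_le (t := s) (w := fun i => y i / Y)
    (p := fun i => x i / y i) (fun i hi => div_nonneg (hy i hi) hY.le)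
    (by rw [← Finset.sum_div, div_self hY.ne']) fun i hi => div_nonneg (hx i hi) (hy i hi)
  have weight_mul_ratio : ∀ i ∈ s, y i / Y * (x i / y i) = x i / Y := fun i hi => by
    rw [div_mul_eq_mul_div, mul_div_cancel_of_imp' (hxy i hi)]
  simp only [smul_eq_mul, ← mul_assoc] at jensen
  rw [Finset.sum_congr rfl weight_mul_ratio,
    Finset.sum_congr rfl fun i hi => congrArg (· * _) (weight_mul_ratio i hi)] at jensen
  simp only [div_mul_eq_mul_div, ← Finset.sum_div] at jensen
  exact (div_le_div_iff_of_pos_right hY).1 jensen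

theorem neg_log_sum_le_sum_mul_log_div {ι : Type*} [Fintype ι] {w y : ι → ℝ}
    (hw : w ∈ stdSimplex ℝ ι) (hy : ∀ i, 0 ≤ y i) (hwy : ∀ i, y i = 0 → w i = 0) :
    -Real.log (∑ i, y i) ≤ ∑ i, w i * Real.log (w i / y i) := by
  simpa only [hw.2, one_mul, one_div, Real.log_inv] using
    sum_mul_log_sum_div_sum_le Finset.univ (fun i _ => hw.1 i) (fun i _ => hy i) fun i _ => hwy i

theorem convexOn_mul_log_div :
    ConvexOn ℝ {p : ℝ × ℝ | 0 ≤ p.1 ∧ 0 ≤ p.2 ∧ (p.2 = 0 → p.1 = 0)}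
      fun p => p.1 * Real.log (p.1 / p.2) := by
  refine convexOn_iff_forall_pos.2 ⟨convex_iff_forall_pos.2 ?_, ?_⟩
  · rintro ⟨x, y⟩ ⟨hx, hy, hxy⟩ ⟨x', y'⟩ ⟨hx', hy', hxy'⟩ s t hs ht -
    refine ⟨add_nonneg (mul_nonneg hs.le hx) (mul_nonneg ht.le hx'),
      add_nonneg (mul_nonneg hs.le hy) (mul_nonneg ht.le hy'), fun h => ?_⟩
    obtain ⟨h, h'⟩ := (add_eq_zero_iff_of_nonneg (mul_nonneg hs.le hy) (mul_nonneg ht.le hy')).1 h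
    have hx0 : x = 0 := hxy ((mul_eq_zero.1 h).resolve_left hs.ne')
    have hx0' : x' = 0 := hxy' ((mul_eq_zero.1 h').resolve_left ht.ne')
    simp [hx0, hx0']
  · rintro ⟨x, y⟩ ⟨hx, hy, hxy⟩ ⟨x', y'⟩ ⟨hx', hy', hxy'⟩ s t hs ht -
    have log_sum := sum_mul_log_sum_div_sum_le Finset.univ (x := ![s * x, t * x'])
      (y := ![s * y, t * y']) (by simp [Fin.forall_fin_two, *])
      (by simp [Fin.forall_fin_two, *])
      (by simpa [Fin.forall_fin_two, hs.ne', ht.ne'] using ⟨hxy, hxy'⟩)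
    simpa [Fin.sum_univ_two, mul_div_mul_left, hs.ne', ht.ne', mul_assoc] using log_sum

theorem deriv_le_of_eventually_le_add_mul {φ : ℝ → ℝ} {φ' x c : ℝ} (hφ : HasDerivAt φ φ' x)
    (h : ∀ᶠ y in nhdsWithin x (Set.Ioi x), φ y ≤ φ x + (y - x) * c) : φ' ≤ c := by
  have slope_tendsto := hφ.hasDerivWithinAt (s := Set.Ioi x)
  rw [hasDerivWithinAt_iff_tendsto_slope' Set.self_notMem_Ioi] at slope_tendsto
  refine le_of_tendsto slope_tendsto ?_
  filter_upwards [h, self_mem_nhdsWithin] with y hy hxy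
  rw [slope_def_field, div_le_iff₀ (sub_pos.2 hxy)]
  linarith

/-- Passing from `z` to `(1 - ε) z + ε k` changes `∑ P log z` at the rate `∑ P (k / z) - 1`. -/
theorem sum_mul_div_le_one_of_sum_mul_log_le {A : Type*} [Fintype A] {P z k : A → ℝ}
    (hP : ∑ a, P a = 1) (hz : ∀ a, z a ≠ 0)
    (hmax : ∀ ε ∈ Set.Ioo (0 : ℝ) 1,
      ∑ a, P a * Real.log ((1 - ε) * z a + ε * k a) ≤ ∑ a, P a * Real.log (z a)) :
    ∑ a, P a * (k a / z a) ≤ 1 := by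
  have hderiv : HasDerivAt (fun ε : ℝ => ∑ a, P a * Real.log (AffineMap.lineMap (z a) (k a) ε))
      (∑ a, P a * ((k a - z a) / z a)) 0 := by
    refine HasDerivAt.fun_sum fun a _ => HasDerivAt.const_mul _ ?_
    simpa using (AffineMap.hasDerivAt_lineMap (a := z a) (b := k a) (x := (0 : ℝ))).log
      (by simpa using hz a)
  have hle := deriv_le_of_eventually_le_add_mul (c := 0) hderiv <| by
    filter_upwards [Ioo_mem_nhdsGT (zero_lt_one' ℝ)] with ε hε
    simpa [AffineMap.lineMap_apply_ring] using hmax ε hε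
  simp only [sub_div, div_self (hz _), mul_sub, mul_one, Finset.sum_sub_distrib, hP] at hle
  linarith

theorem sum_mul_exp_pos {B : Type*} [Fintype B] {Q : B → ℝ} (hQ : Q ∈ stdSimplex ℝ B)
    (f : B → ℝ) : 0 < ∑ b, Q b * Real.exp (f b) := by
  obtain ⟨b, -, hb⟩ : ∃ b ∈ Finset.univ, 0 < Q b :=
    Finset.exists_lt_of_sum_lt (by simp [hQ.2])
  exact Finset.sum_pos' (fun b _ => mul_nonneg (hQ.1 b) (Real.exp_pos _).le)
    ⟨b, Finset.mem_univ b, mul_pos hb (Real.exp_pos _)⟩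

end RealInequalities

section RateDistortion

variable {A B : Type*}

theorem outputLaw_add_smul [Fintype A] (P : A → ℝ) (V W : A → B → ℝ) (s t : ℝ) (b : B) :
    outputLaw P (s • V + t • W) b = s * outputLaw P V b + t * outputLaw P W b := by
  simp only [outputLaw, Pi.add_apply, Pi.smul_apply, smul_eq_mul, mul_add, Finset.sum_add_distrib,
    Finset.mul_sum, mul_left_comm]

variable [Fintype B]

theorem IsKernel.nonneg {W : A → B → ℝ} (hW : IsKernel W) (a : A) (b : B) : 0 ≤ W a b :=
  (hW a).1 b

theorem IsKernel.sum_eq_one {W : A → B → ℝ} (hW : IsKernel W) (a : A) : ∑ b, W a b = 1 :=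
  (hW a).2

theorem convex_setOf_isKernel : Convex ℝ {W : A → B → ℝ | IsKernel W} :=
  fun _ hV _ hW _ _ hs ht hst a => convex_stdSimplex ℝ B (hV a) (hW a) hs ht hst

variable [Fintype A] {P : A → ℝ} {W : A → B → ℝ}

theorem expDistortion_add_smul (P : A → ℝ) (d V W : A → B → ℝ) (s t : ℝ) :
    expDistortion P d (s • V + t • W) = s * expDistortion P d V + t * expDistortion P d W := by
  simp only [expDistortion, Pi.add_apply, Pi.smul_apply, smul_eq_mul, mul_add, add_mul,
    Finset.sum_add_distrib, Finset.mul_sum, mul_left_comm, mul_assoc]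

theorem outputLaw_nonneg (hP : ∀ a, 0 ≤ P a) (hW : IsKernel W) (b : B) : 0 ≤ outputLaw P W b :=
  Finset.sum_nonneg fun a _ => mul_nonneg (hP a) (hW.nonneg a b)

theorem outputLaw_mem_stdSimplex (hP : P ∈ stdSimplex ℝ A) (hW : IsKernel W) :
    outputLaw P W ∈ stdSimplex ℝ B :=
  ⟨outputLaw_nonneg hP.1 hW, by
    simp only [outputLaw]
    rw [Finset.sum_comm]
    simp only [← Finset.mul_sum, hW.sum_eq_one, mul_one, hP.2]⟩

theorem mul_eq_zero_of_outputLaw_eq_zero (hP : ∀ a, 0 ≤ P a) (hW : IsKernel W) {b : B}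
    (hb : outputLaw P W b = 0) (a : A) : P a * W a b = 0 :=
  (Finset.sum_eq_zero_iff_of_nonneg fun a _ => mul_nonneg (hP a) (hW.nonneg a b)).1 hb a
    (Finset.mem_univ a)

theorem convexOn_mutualInfo (hP : ∀ a, 0 ≤ P a) :
    ConvexOn ℝ {W : A → B → ℝ | IsKernel W} (mutualInfo P) := by
  refine ⟨convex_setOf_isKernel, fun V hV W hW s t hs ht hst => ?_⟩
  simp only [mutualInfo, smul_eq_mul, Finset.mul_sum, ← Finset.sum_add_distrib]
  refine Finset.sum_le_sum fun a _ => Finset.sum_le_sum fun b _ => ?_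
  rcases (hP a).eq_or_lt with ha | ha
  · simp [← ha]
  have support {U : A → B → ℝ} (hU : IsKernel U) : outputLaw P U b = 0 → U a b = 0 := fun h =>
    (mul_eq_zero.1 (mul_eq_zero_of_outputLaw_eq_zero hP hU h a)).resolve_left ha.ne'
  have termwise := convexOn_mul_log_div.2
    (x := (V a b, outputLaw P V b)) ⟨hV.nonneg a b, outputLaw_nonneg hP hV b, support hV⟩
    (y := (W a b, outputLaw P W b)) ⟨hW.nonneg a b, outputLaw_nonneg hP hW b, support hW⟩
    hs ht hst
  simp only [Prod.smul_mk, Prod.mk_add_mk, smul_eq_mul] at termwise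
  rw [outputLaw_add_smul]
  calc P a * (s * V a b + t * W a b) * Real.log ((s * V a b + t * W a b) /
        (s * outputLaw P V b + t * outputLaw P W b))
      ≤ P a * (s * (V a b * Real.log (V a b / outputLaw P V b)) +
          t * (W a b * Real.log (W a b / outputLaw P W b))) := by
        rw [mul_assoc]; exact mul_le_mul_of_nonneg_left termwise ha.le
    _ = _ := by ring

/-- The conditional relative entropy `D(W ‖ Q | P)` of a kernel with respect to an output law. At
`Q = outputLaw P W` it is the mutual information. -/
noncomputable def condRelEntropy (P : A → ℝ) (W : A → B → ℝ) (Q : B → ℝ) : ℝ :=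
  ∑ a, ∑ b, P a * W a b * Real.log (W a b / Q b)

theorem condRelEntropy_eq_mutualInfo_add {Q : B → ℝ} (hP : ∀ a, 0 ≤ P a) (hW : IsKernel W)
    (hQ : ∀ b, Q b = 0 → ∀ a, P a * W a b = 0) :
    condRelEntropy P W Q =
      mutualInfo P W + ∑ b, outputLaw P W b * Real.log (outputLaw P W b / Q b) := by
  have expand : ∑ b, outputLaw P W b * Real.log (outputLaw P W b / Q b) =
      ∑ a, ∑ b, P a * W a b * Real.log (outputLaw P W b / Q b) := by
    rw [Finset.sum_comm]
    exact Finset.sum_congr rfl fun b _ => Finset.sum_mul ..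
  rw [expand, condRelEntropy, mutualInfo]
  simp only [← Finset.sum_add_distrib, ← mul_add]
  refine Finset.sum_congr rfl fun a _ => Finset.sum_congr rfl fun b _ => ?_
  rcases eq_or_ne (P a * W a b) 0 with h | h
  · simp only [h, zero_mul]
  have hq : outputLaw P W b ≠ 0 := fun hb => h (mul_eq_zero_of_outputLaw_eq_zero hP hW hb a)
  have hQb : Q b ≠ 0 := fun hb => h (hQ b hb a)
  rw [← Real.log_mul (div_ne_zero (right_ne_zero_of_mul h) hq) (div_ne_zero hq hQb),
    div_mul_div_cancel₀ hq]

theorem mutualInfo_le_condRelEntropy {Q : B → ℝ} (hP : P ∈ stdSimplex ℝ A) (hW : IsKernel W)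
    (hQ : Q ∈ stdSimplex ℝ B) (hWQ : ∀ b, Q b = 0 → ∀ a, P a * W a b = 0) :
    mutualInfo P W ≤ condRelEntropy P W Q := by
  have gibbs := neg_log_sum_le_sum_mul_log_div (outputLaw_mem_stdSimplex hP hW) hQ.1
    fun b hb => Finset.sum_eq_zero fun a _ => hWQ b hb a
  rw [hQ.2, Real.log_one, neg_zero] at gibbs
  rw [condRelEntropy_eq_mutualInfo_add hP.1 hW hWQ]
  exact le_add_of_nonneg_right gibbs

theorem mutualInfo_nonneg (hP : P ∈ stdSimplex ℝ A) (hW : IsKernel W) : 0 ≤ mutualInfo P W := by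
  have hq := outputLaw_mem_stdSimplex hP hW
  refine Finset.sum_nonneg fun a _ => ?_
  rcases (hP.1 a).eq_or_lt with ha | ha
  · simp [← ha]
  have gibbs := neg_log_sum_le_sum_mul_log_div (hW a) hq.1 fun b hb =>
    (mul_eq_zero.1 (mul_eq_zero_of_outputLaw_eq_zero hP.1 hW hb a)).resolve_left ha.ne'
  rw [hq.2, Real.log_one, neg_zero] at gibbs
  simp only [mul_assoc, ← Finset.mul_sum]
  exact mul_nonneg ha.le gibbs

end RateDistortion

section TiltedInformation

variable {A B : Type*}

/-- The unnormalized law `Q(b) exp (l D - l d(a,b))` of the output given `a`; at the slope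
`l = -R'(D)` and the optimal output law, its total mass is `exp (-j(a,D))`. -/
noncomputable def tiltedWeight (d : A → B → ℝ) (D l : ℝ) (Q : B → ℝ) (a : A) (b : B) : ℝ :=
  Q b * Real.exp (l * D - l * d a b)

theorem tiltedWeight_eq_zero_iff {d : A → B → ℝ} {D l : ℝ} {Q : B → ℝ} {a : A} {b : B} :
    tiltedWeight d D l Q a b = 0 ↔ Q b = 0 := by
  simp [tiltedWeight]

variable [Fintype B]

/-- The normalizing constant of `tiltedWeight`. -/
noncomputable def tiltedMass (d : A → B → ℝ) (D l : ℝ) (Q : B → ℝ) (a : A) : ℝ :=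
  ∑ b, tiltedWeight d D l Q a b

/-- The Gibbs kernel with prior `Q` and inverse temperature `l`, which minimizes the Lagrangian
`W ↦ condRelEntropy P W Q + l * expDistortion P d W`. -/
noncomputable def gibbsKernel (d : A → B → ℝ) (D l : ℝ) (Q : B → ℝ) (a : A) (b : B) : ℝ :=
  tiltedWeight d D l Q a b / tiltedMass d D l Q a

variable {Q : B → ℝ}

theorem tiltedMass_pos (d : A → B → ℝ) (D l : ℝ) (hQ : Q ∈ stdSimplex ℝ B) (a : A) :
    0 < tiltedMass d D l Q a :=
  sum_mul_exp_pos hQ _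

theorem gibbsKernel_eq_zero {d : A → B → ℝ} {D l : ℝ} {b : B} (hb : Q b = 0) (a : A) :
    gibbsKernel d D l Q a b = 0 := by
  rw [gibbsKernel, tiltedWeight_eq_zero_iff.2 hb, zero_div]

theorem isKernel_gibbsKernel (d : A → B → ℝ) (D l : ℝ) (hQ : Q ∈ stdSimplex ℝ B) :
    IsKernel (gibbsKernel d D l Q) := fun a =>
  ⟨fun b => div_nonneg (mul_nonneg (hQ.1 b) (Real.exp_pos _).le) (tiltedMass_pos d D l hQ a).le, by
    simp only [gibbsKernel, ← Finset.sum_div]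
    exact div_self (tiltedMass_pos d D l hQ a).ne'⟩

theorem tiltedMass_add_smul (d : A → B → ℝ) (D l : ℝ) (Q Q' : B → ℝ) (s t : ℝ) (a : A) :
    tiltedMass d D l (s • Q + t • Q') a =
      s * tiltedMass d D l Q a + t * tiltedMass d D l Q' a := by
  simp only [tiltedMass, tiltedWeight, Pi.add_apply, Pi.smul_apply, smul_eq_mul, add_mul,
    Finset.sum_add_distrib, Finset.mul_sum, mul_assoc]

theorem tiltedMass_single [DecidableEq B] (d : A → B → ℝ) (D l : ℝ) (b : B) (a : A) :
    tiltedMass d D l (Pi.single b 1) a = Real.exp (l * D - l * d a b) := by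
  simp [tiltedMass, tiltedWeight, Pi.single_apply]

variable [Fintype A] {P : A → ℝ} {d : A → B → ℝ} {D : ℝ} {V W : A → B → ℝ}

theorem condRelEntropy_add_mul_expDistortion_sub (hP : P ∈ stdSimplex ℝ A) (d : A → B → ℝ)
    (D l : ℝ) (hW : IsKernel W) (hWQ : ∀ b, Q b = 0 → ∀ a, P a * W a b = 0) :
    condRelEntropy P W Q + l * (expDistortion P d W - D) =
      ∑ a, P a * ∑ b, W a b * Real.log (W a b / tiltedWeight d D l Q a b) := by
  have termwise (a : A) (b : B) : P a * (W a b * Real.log (W a b / tiltedWeight d D l Q a b)) =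
      P a * W a b * Real.log (W a b / Q b) + l * (P a * W a b * d a b) -
        l * D * (P a * W a b) := by
    rcases eq_or_ne (P a * W a b) 0 with h | h
    · simp only [← mul_assoc, h, zero_mul, mul_zero, add_zero, sub_zero]
    have hQb : Q b ≠ 0 := fun hb => h (hWQ b hb a)
    rw [tiltedWeight, ← div_div,
      Real.log_div (div_ne_zero (right_ne_zero_of_mul h) hQb) (Real.exp_ne_zero _), Real.log_exp]
    ring
  simp only [Finset.mul_sum, termwise, Finset.sum_sub_distrib, Finset.sum_add_distrib]
  simp only [← Finset.mul_sum, hW.sum_eq_one, mul_one, hP.2]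
  rw [condRelEntropy, expDistortion, mul_sub, add_sub_assoc]

theorem neg_sum_log_tiltedMass_le (hP : P ∈ stdSimplex ℝ A) (d : A → B → ℝ) (D l : ℝ)
    (hQ : ∀ b, 0 ≤ Q b) (hW : IsKernel W) (hWQ : ∀ b, Q b = 0 → ∀ a, P a * W a b = 0) :
    -∑ a, P a * Real.log (tiltedMass d D l Q a) ≤
      condRelEntropy P W Q + l * (expDistortion P d W - D) := by
  rw [condRelEntropy_add_mul_expDistortion_sub hP d D l hW hWQ, ← Finset.sum_neg_distrib]
  refine Finset.sum_le_sum fun a _ => ?_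
  rcases (hP.1 a).eq_or_lt with ha | ha
  · simp [← ha]
  rw [← mul_neg]
  refine mul_le_mul_of_nonneg_left (neg_log_sum_le_sum_mul_log_div (hW a)
    (fun b => mul_nonneg (hQ b) (Real.exp_pos _).le) fun b hb => ?_) ha.le
  exact (mul_eq_zero.1 (hWQ b (tiltedWeight_eq_zero_iff.1 hb) a)).resolve_left ha.ne'

theorem condRelEntropy_gibbsKernel_add (hP : P ∈ stdSimplex ℝ A) (d : A → B → ℝ) (D l : ℝ)
    (hQ : Q ∈ stdSimplex ℝ B) :
    condRelEntropy P (gibbsKernel d D l Q) Q +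
        l * (expDistortion P d (gibbsKernel d D l Q) - D) =
      -∑ a, P a * Real.log (tiltedMass d D l Q a) := by
  have hV := isKernel_gibbsKernel d D l hQ
  have termwise (a : A) (b : B) : gibbsKernel d D l Q a b *
      Real.log (gibbsKernel d D l Q a b / tiltedWeight d D l Q a b) =
      gibbsKernel d D l Q a b * -Real.log (tiltedMass d D l Q a) := by
    rcases eq_or_ne (Q b) 0 with hb | hb
    · simp only [gibbsKernel_eq_zero hb, zero_mul]
    rw [gibbsKernel, div_div_cancel_left' (mt tiltedWeight_eq_zero_iff.1 hb), Real.log_inv]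
  rw [condRelEntropy_add_mul_expDistortion_sub hP d D l hV fun b hb a => by
    rw [gibbsKernel_eq_zero hb, mul_zero]]
  simp only [termwise, ← Finset.sum_mul, hV.sum_eq_one, one_mul, mul_neg, Finset.sum_neg_distrib]

theorem rateDistortion_le_mutualInfo (hP : P ∈ stdSimplex ℝ A) (hW : IsKernel W)
    (hD : expDistortion P d W ≤ D) : rateDistortion P d D ≤ mutualInfo P W :=
  csInf_le ⟨0, by rintro _ ⟨V, hV, -, rfl⟩; exact mutualInfo_nonneg hP hV⟩ ⟨W, hW, hD, rfl⟩

/-- The slope `λ* = -R'(D)`, which is the tilting exponent in `tiltedInfo`. -/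
noncomputable def optimalSlope (P : A → ℝ) (d : A → B → ℝ) (D : ℝ) : ℝ :=
  -deriv (rateDistortion P d) D

/-- Mixing `W` with `V` puts the chord from `(D, R(D))` to `(D', I(V))` above the graph of `R`. -/
theorem IsOptimalTestChannel.rateDistortion_sub_le (hW : IsOptimalTestChannel P d D W)
    (hP : P ∈ stdSimplex ℝ A) (hR : DifferentiableAt ℝ (rateDistortion P d) D) (hV : IsKernel V)
    {D' : ℝ} (hD' : expDistortion P d V ≤ D') :
    rateDistortion P d D - optimalSlope P d D * (D' - D) ≤ mutualInfo P V := by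
  have chord : ∀ ε ∈ Set.Ioo (0 : ℝ) 1, rateDistortion P d (AffineMap.lineMap D D' ε) ≤
      (1 - ε) * rateDistortion P d D + ε * mutualInfo P V := fun ε hε => by
    have h1ε : 0 ≤ 1 - ε := sub_nonneg.2 hε.2.le
    have feasible : expDistortion P d ((1 - ε) • W + ε • V) ≤ AffineMap.lineMap D D' ε := by
      rw [expDistortion_add_smul, AffineMap.lineMap_apply_ring]
      exact add_le_add (mul_le_mul_of_nonneg_left hW.2.1 h1ε)
        (mul_le_mul_of_nonneg_left hD' hε.1.le)
    have convex := (convexOn_mutualInfo hP.1).2 hW.1 hV h1ε hε.1.le (sub_add_cancel 1 ε)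
    rw [smul_eq_mul, smul_eq_mul, hW.2.2] at convex
    exact (rateDistortion_le_mutualInfo hP (convex_setOf_isKernel hW.1 hV h1ε hε.1.le
      (sub_add_cancel 1 ε)) feasible).trans convex
  have hderiv : HasDerivAt (fun ε : ℝ => rateDistortion P d (AffineMap.lineMap D D' ε))
      (deriv (rateDistortion P d) D * (D' - D)) 0 :=
    HasDerivAt.comp (0 : ℝ) (h₂ := rateDistortion P d)
      (by rw [AffineMap.lineMap_apply_zero]; exact hR.hasDerivAt) AffineMap.hasDerivAt_lineMap
  have slope_le := deriv_le_of_eventually_le_add_mul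
    (c := mutualInfo P V - rateDistortion P d D) hderiv <| by
      filter_upwards [Ioo_mem_nhdsGT (zero_lt_one' ℝ)] with ε hε
      have := chord ε hε
      simp only [AffineMap.lineMap_apply_zero]
      linarith
  simp only [optimalSlope]
  linarith

theorem IsOptimalTestChannel.optimalSlope_nonneg (hW : IsOptimalTestChannel P d D W)
    (hP : P ∈ stdSimplex ℝ A) (hR : DifferentiableAt ℝ (rateDistortion P d) D) :
    0 ≤ optimalSlope P d D := by
  have h := hW.rateDistortion_sub_le hP hR hW.1 (hW.2.1.trans (le_add_of_nonneg_right zero_le_one))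
  rw [hW.2.2] at h
  linarith

theorem IsOptimalTestChannel.sum_log_tiltedMass_le (hW : IsOptimalTestChannel P d D W)
    (hP : P ∈ stdSimplex ℝ A) (hR : DifferentiableAt ℝ (rateDistortion P d) D)
    (hQ : Q ∈ stdSimplex ℝ B) :
    ∑ a, P a * Real.log (tiltedMass d D (optimalSlope P d D) Q a) ≤
      ∑ a, P a * Real.log (tiltedMass d D (optimalSlope P d D) (outputLaw P W) a) := by
  set l := optimalSlope P d D
  set V := gibbsKernel d D l Q
  have hV : IsKernel V := isKernel_gibbsKernel d D l hQ
  have hVQ : ∀ b, Q b = 0 → ∀ a, P a * V a b = 0 := fun b hb a => by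
    simp only [V, gibbsKernel_eq_zero hb, mul_zero]
  refine neg_le_neg_iff.1 ?_
  calc -∑ a, P a * Real.log (tiltedMass d D l (outputLaw P W) a)
      ≤ mutualInfo P W + l * (expDistortion P d W - D) :=
        neg_sum_log_tiltedMass_le hP d D l (outputLaw_nonneg hP.1 hW.1) hW.1
          fun b hb => mul_eq_zero_of_outputLaw_eq_zero hP.1 hW.1 hb
    _ ≤ rateDistortion P d D := by
        rw [hW.2.2]
        exact add_le_of_nonpos_right <|
          mul_nonpos_of_nonneg_of_nonpos (hW.optimalSlope_nonneg hP hR) (sub_nonpos.2 hW.2.1)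
    _ ≤ mutualInfo P V + l * (expDistortion P d V - D) :=
        sub_le_iff_le_add.1 (hW.rateDistortion_sub_le hP hR hV le_rfl)
    _ ≤ condRelEntropy P V Q + l * (expDistortion P d V - D) :=
        add_le_add_left (mutualInfo_le_condRelEntropy hP hV hQ hVQ) _
    _ = -∑ a, P a * Real.log (tiltedMass d D l Q a) :=
        condRelEntropy_gibbsKernel_add hP d D l hQ

theorem IsOptimalTestChannel.sum_mul_exp_div_tiltedMass_le_one (hW : IsOptimalTestChannel P d D W)
    (hP : P ∈ stdSimplex ℝ A) (hR : DifferentiableAt ℝ (rateDistortion P d) D) (b : B) :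
    ∑ a, P a * (Real.exp (optimalSlope P d D * D - optimalSlope P d D * d a b) /
      tiltedMass d D (optimalSlope P d D) (outputLaw P W) a) ≤ 1 := by
  classical
  have hq := outputLaw_mem_stdSimplex hP hW.1
  refine sum_mul_div_le_one_of_sum_mul_log_le hP.2 (fun a => (tiltedMass_pos d D _ hq a).ne')
    fun ε hε => ?_
  simpa only [tiltedMass_add_smul, tiltedMass_single] using
    hW.sum_log_tiltedMass_le hP hR <| convex_stdSimplex ℝ B hq (single_mem_stdSimplex ℝ b)
      (sub_nonneg.2 hε.2.le) hε.1.le (sub_add_cancel 1 ε)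

theorem exp_tiltedInfo (hP : P ∈ stdSimplex ℝ A) (d : A → B → ℝ) (D : ℝ) (hW : IsKernel W)
    (a : A) : Real.exp (tiltedInfo P d D W a) =
      1 / tiltedMass d D (optimalSlope P d D) (outputLaw P W) a :=
  Real.exp_log (one_div_pos.2 (tiltedMass_pos d D _ (outputLaw_mem_stdSimplex hP hW) a))

theorem IsOptimalTestChannel.sum_exp_tiltedInfo_le_one (hW : IsOptimalTestChannel P d D W)
    (hP : P ∈ stdSimplex ℝ A) (hR : DifferentiableAt ℝ (rateDistortion P d) D) (b : B) :
    ∑ a, P a * (Real.exp (tiltedInfo P d D W a) * if d a b ≤ D then 1 else 0) ≤ 1 := by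
  refine le_trans (Finset.sum_le_sum fun a _ => mul_le_mul_of_nonneg_left ?_ (hP.1 a))
    (hW.sum_mul_exp_div_tiltedMass_le_one hP hR b)
  rw [exp_tiltedInfo hP d D hW.1, div_mul_eq_mul_div, one_mul]
  refine div_le_div_of_nonneg_right ?_
    (tiltedMass_pos d D _ (outputLaw_mem_stdSimplex hP hW.1) a).le
  split_ifs with h
  · rw [← mul_sub]
    exact Real.one_le_exp (mul_nonneg (hW.optimalSlope_nonneg hP hR) (sub_nonneg.2 h))
  · exact (Real.exp_pos _).le

end TiltedInformation

section Derandomization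

theorem exists_le_sum_mul {ι : Type*} [Fintype ι] {w : ι → ℝ} (hw : w ∈ stdSimplex ℝ ι)
    (f : ι → ℝ) : ∃ i, f i ≤ ∑ j, w j * f j := by
  rcases isEmpty_or_nonempty ι with _ | _
  · simp [stdSimplex_of_isEmpty_index] at hw
  obtain ⟨i, hi⟩ := Finite.exists_min f
  refine ⟨i, ?_⟩
  calc f i = ∑ j, w j * f i := by rw [← Finset.sum_mul, hw.2, one_mul]
    _ ≤ ∑ j, w j * f j :=
        Finset.sum_le_sum fun j _ => mul_le_mul_of_nonneg_left (hi j) (hw.1 j)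

theorem IsKernel.exists_sum_le_sum_mul {ι Y T : Type*} [Fintype ι] [Fintype T]
    {W : Y → T → ℝ} (hW : IsKernel W) (f : ι → Y) (φ : ι → T → ℝ) :
    ∃ g : Y → T, ∑ i, φ i (g (f i)) ≤ ∑ i, ∑ t, W (f i) t * φ i t := by
  classical
  choose g hg using fun y => exists_le_sum_mul (hW y) fun t => ∑ i with f i = y, φ i t
  have sum_fiber (ψ : ι → ℝ) :
      ∑ y ∈ Finset.univ.image f, ∑ i with f i = y, ψ i = ∑ i, ψ i :=
    Finset.sum_fiberwise_of_maps_to (fun i hi => Finset.mem_image_of_mem f hi) ψ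
  refine ⟨g, ?_⟩
  calc ∑ i, φ i (g (f i)) = ∑ y ∈ Finset.univ.image f, ∑ i with f i = y, φ i (g y) := by
        rw [← sum_fiber]
        exact Finset.sum_congr rfl fun y _ => Finset.sum_congr rfl fun i hi => by
          rw [(Finset.mem_filter.1 hi).2]
    _ ≤ ∑ y ∈ Finset.univ.image f, ∑ t, W y t * ∑ i with f i = y, φ i t :=
        Finset.sum_le_sum fun y _ => hg y
    _ = ∑ y ∈ Finset.univ.image f, ∑ i with f i = y, ∑ t, W (f i) t * φ i t := by
        refine Finset.sum_congr rfl fun y _ => ?_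
        simp only [Finset.mul_sum]
        rw [Finset.sum_comm]
        exact Finset.sum_congr rfl fun i hi => by rw [(Finset.mem_filter.1 hi).2]
    _ = ∑ i, ∑ t, W (f i) t * φ i t := sum_fiber _

theorem sum_noiseless_mul {M : ℕ} (x : Fin M) (φ : Fin M → ℝ) :
    ∑ y, noiseless y x * φ y = φ x := by
  simp [noiseless]

variable {S T₁ T₂ : Type*} [Fintype S] [Fintype T₁] [Fintype T₂] {M₁ M₂ : ℕ}

theorem RandCode.excessProb_eq (c : RandCode S T₁ T₂ M₁ M₂) (P : S → ℝ)
    (d₁ : S → T₁ → ℝ) (d₂ : S → T₂ → ℝ) (D₁ D₂ : ℝ) :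
    c.excessProb P d₁ d₂ D₁ D₂ = ∑ s, ∑ x₁, c.qX₁ s x₁ * ∑ x₂, c.qX₂ s x₂ *
      ∑ t₁, c.qT₁ x₁ t₁ * ∑ t₂, c.qT₂ (x₁, x₂) t₂ *
        (P s * excessLoss d₁ d₂ D₁ D₂ s t₁ t₂) := by
  refine Finset.sum_congr rfl fun s _ => Finset.sum_congr rfl fun x₁ _ => ?_
  rw [Finset.mul_sum]
  refine Finset.sum_congr rfl fun x₂ _ => ?_
  rw [← sum_noiseless_mul x₁ fun y₁ => c.qX₁ s x₁ * (c.qX₂ s x₂ * ∑ t₁, c.qT₁ y₁ t₁ *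
    ∑ t₂, c.qT₂ (y₁, x₂) t₂ * (P s * excessLoss d₁ d₂ D₁ D₂ s t₁ t₂))]
  refine Finset.sum_congr rfl fun y₁ _ => ?_
  rw [← sum_noiseless_mul x₂ fun y₂ => c.qX₁ s x₁ * (c.qX₂ s x₂ * ∑ t₁, c.qT₁ y₁ t₁ *
    ∑ t₂, c.qT₂ (y₁, y₂) t₂ * (P s * excessLoss d₁ d₂ D₁ D₂ s t₁ t₂)), Finset.mul_sum]
  refine Finset.sum_congr rfl fun y₂ _ => ?_
  simp only [Finset.mul_sum]
  exact Finset.sum_congr rfl fun t₁ _ => Finset.sum_congr rfl fun t₂ _ => by ring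

theorem RandCode.exists_code_excessProb_le (c : RandCode S T₁ T₂ M₁ M₂) (P : S → ℝ)
    (d₁ : S → T₁ → ℝ) (d₂ : S → T₂ → ℝ) (D₁ D₂ : ℝ) :
    ∃ c' : Code S T₁ T₂ M₁ M₂, c'.excessProb P d₁ d₂ D₁ D₂ ≤ c.excessProb P d₁ d₂ D₁ D₂ := by
  obtain ⟨f₁, hf₁⟩ := c.qX₁_kernel.exists_sum_le_sum_mul id fun s x₁ => ∑ x₂, c.qX₂ s x₂ *
    ∑ t₁, c.qT₁ x₁ t₁ * ∑ t₂, c.qT₂ (x₁, x₂) t₂ * (P s * excessLoss d₁ d₂ D₁ D₂ s t₁ t₂)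
  obtain ⟨f₂, hf₂⟩ := c.qX₂_kernel.exists_sum_le_sum_mul id fun s x₂ =>
    ∑ t₁, c.qT₁ (f₁ s) t₁ * ∑ t₂, c.qT₂ (f₁ s, x₂) t₂ * (P s * excessLoss d₁ d₂ D₁ D₂ s t₁ t₂)
  obtain ⟨g₁, hg₁⟩ := c.qT₁_kernel.exists_sum_le_sum_mul f₁ fun s t₁ =>
    ∑ t₂, c.qT₂ (f₁ s, f₂ s) t₂ * (P s * excessLoss d₁ d₂ D₁ D₂ s t₁ t₂)
  obtain ⟨g₂, hg₂⟩ := c.qT₂_kernel.exists_sum_le_sum_mul (fun s => (f₁ s, f₂ s)) fun s t₂ =>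
    P s * excessLoss d₁ d₂ D₁ D₂ s (g₁ (f₁ s)) t₂
  exact ⟨⟨f₁, f₂, g₁, fun y₁ y₂ => g₂ (y₁, y₂)⟩,
    (((hg₂.trans hg₁).trans hf₂).trans hf₁).trans_eq (c.excessProb_eq P d₁ d₂ D₁ D₂).symm⟩

end Derandomization

section WeakDuality

variable {S T₁ T₂ : Type*} [Fintype S] {M₁ M₂ : ℕ} {P : S → ℝ}
  {d₁ : S → T₁ → ℝ} {d₂ : S → T₂ → ℝ} {D₁ D₂ : ℝ} {F : DualVars S T₁ T₂ M₁ M₂}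

theorem DualVars.Feasible.η₁_le (hF : F.Feasible P d₁ d₂ D₁ D₂) (g₁ : Fin M₁ → T₁) (s : S)
    (x₁ : Fin M₁) (x₂ : Fin M₂) :
    F.η₁ s ≤ ∑ y₁, ∑ y₂, F.lamC s x₁ x₂ y₁ y₂ (g₁ y₁) :=
  calc F.η₁ s ≤ F.δ₁ x₂ s := sub_nonpos.1 (hF.c1 s x₂)
    _ ≤ ∑ y₁, F.μ s x₁ x₂ y₁ := neg_add_nonpos_iff.1 (hF.c6 s x₁ x₂)
    _ ≤ ∑ y₁, ∑ y₂, F.lamC s x₁ x₂ y₁ y₂ (g₁ y₁) :=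
        Finset.sum_le_sum fun y₁ _ => neg_add_nonpos_iff.1 (hF.c5 s x₁ x₂ y₁ (g₁ y₁))

theorem DualVars.Feasible.η₂_le (hF : F.Feasible P d₁ d₂ D₁ D₂) (f₂ : S → Fin M₂)
    (g₂ : Fin M₁ → Fin M₂ → T₂) (y₁ : Fin M₁) (t₁ : T₁) :
    F.η₂ y₁ ≤ ∑ s, ∑ y₂, F.lamA s (f₂ s) y₁ y₂ t₁ (g₂ y₁ y₂) :=
  calc F.η₂ y₁ ≤ ∑ s, F.δ₃ s t₁ y₁ := sub_nonpos.1 (hF.c2 y₁ t₁)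
    _ ≤ ∑ s, ∑ y₂, F.γ (f₂ s) s t₁ y₁ y₂ :=
        Finset.sum_le_sum fun s _ => neg_add_nonpos_iff.1 (hF.c8 s (f₂ s) y₁ t₁)
    _ ≤ ∑ s, ∑ y₂, F.lamA s (f₂ s) y₁ y₂ t₁ (g₂ y₁ y₂) :=
        Finset.sum_le_sum fun s _ => Finset.sum_le_sum fun y₂ _ =>
          neg_add_nonpos_iff.1 (hF.c10 s (f₂ s) y₁ y₂ t₁ (g₂ y₁ y₂))

theorem DualVars.Feasible.η₃_le (hF : F.Feasible P d₁ d₂ D₁ D₂) (f₁ : S → Fin M₁)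
    (y₁ : Fin M₁) (y₂ : Fin M₂) (t₁ : T₁) (t₂ : T₂) :
    F.η₃ y₁ y₂ ≤ ∑ s, F.lamB s (f₁ s) y₁ y₂ t₁ t₂ :=
  calc F.η₃ y₁ y₂ ≤ ∑ s, F.δ₂ s t₂ y₁ y₂ := sub_nonpos.1 (hF.c3 y₁ y₂ t₂)
    _ ≤ ∑ s, F.θ (f₁ s) s y₁ t₂ y₂ :=
        Finset.sum_le_sum fun s _ => neg_add_nonpos_iff.1 (hF.c7 s (f₁ s) y₁ y₂ t₂)
    _ ≤ ∑ s, F.lamB s (f₁ s) y₁ y₂ t₁ t₂ :=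
        Finset.sum_le_sum fun s _ => neg_add_nonpos_iff.1 (hF.c9 s (f₁ s) y₁ y₂ t₁ t₂)

theorem Code.excessProb_eq_sum_noiseless (c : Code S T₁ T₂ M₁ M₂) (P : S → ℝ)
    (d₁ : S → T₁ → ℝ) (d₂ : S → T₂ → ℝ) (D₁ D₂ : ℝ) :
    c.excessProb P d₁ d₂ D₁ D₂ = ∑ s, ∑ y₁, ∑ y₂,
      P s * noiseless y₁ (c.f₁ s) * noiseless y₂ (c.f₂ s) *
        excessLoss d₁ d₂ D₁ D₂ s (c.g₁ y₁) (c.g₂ y₁ y₂) := by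
  simp [Code.excessProb, noiseless]

theorem DualVars.Feasible.objective_le_excessProb (hF : F.Feasible P d₁ d₂ D₁ D₂)
    (c : Code S T₁ T₂ M₁ M₂) : F.objective ≤ c.excessProb P d₁ d₂ D₁ D₂ := by
  have sum_η₂_le : ∑ y₁, F.η₂ y₁ ≤
      ∑ s, ∑ y₁, ∑ y₂, F.lamA s (c.f₂ s) y₁ y₂ (c.g₁ y₁) (c.g₂ y₁ y₂) :=
    le_of_le_of_eq (Finset.sum_le_sum fun y₁ _ => hF.η₂_le c.f₂ c.g₂ y₁ (c.g₁ y₁)) Finset.sum_comm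
  have sum_η₃_le : ∑ y₁, ∑ y₂, F.η₃ y₁ y₂ ≤
      ∑ s, ∑ y₁, ∑ y₂, F.lamB s (c.f₁ s) y₁ y₂ (c.g₁ y₁) (c.g₂ y₁ y₂) := by
    refine le_of_le_of_eq (Finset.sum_le_sum fun y₁ _ => ?_) Finset.sum_comm
    exact le_of_le_of_eq (Finset.sum_le_sum fun y₂ _ =>
      hF.η₃_le c.f₁ y₁ y₂ (c.g₁ y₁) (c.g₂ y₁ y₂)) Finset.sum_comm
  rw [c.excessProb_eq_sum_noiseless]
  calc F.objective
      ≤ (∑ s, ∑ y₁, ∑ y₂, F.lamC s (c.f₁ s) (c.f₂ s) y₁ y₂ (c.g₁ y₁)) +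
        (∑ s, ∑ y₁, ∑ y₂, F.lamA s (c.f₂ s) y₁ y₂ (c.g₁ y₁) (c.g₂ y₁ y₂)) +
        ∑ s, ∑ y₁, ∑ y₂, F.lamB s (c.f₁ s) y₁ y₂ (c.g₁ y₁) (c.g₂ y₁ y₂) :=
        add_le_add (add_le_add (Finset.sum_le_sum fun s _ =>
          hF.η₁_le c.g₁ s (c.f₁ s) (c.f₂ s)) sum_η₂_le) sum_η₃_le
    _ ≤ _ := by
        simp only [← Finset.sum_add_distrib]
        refine Finset.sum_le_sum fun s _ => Finset.sum_le_sum fun y₁ _ =>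
          Finset.sum_le_sum fun y₂ _ => ?_
        linarith [hF.c4 s (c.f₁ s) (c.f₂ s) y₁ y₂ (c.g₁ y₁) (c.g₂ y₁ y₂)]

theorem optDPSR_le_code (P : S → ℝ) (d₁ : S → T₁ → ℝ) (d₂ : S → T₂ → ℝ) (D₁ D₂ : ℝ)
    (c : Code S T₁ T₂ M₁ M₂) :
    optDPSR M₁ M₂ P d₁ d₂ D₁ D₂ ≤ ((c.excessProb P d₁ d₂ D₁ D₂ : ℝ) : EReal) :=
  iSup₂_le fun _ hF => EReal.coe_le_coe_iff.2 (hF.objective_le_excessProb c)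

theorem optDPSR_le_randCode [Fintype T₁] [Fintype T₂] (P : S → ℝ) (d₁ : S → T₁ → ℝ)
    (d₂ : S → T₂ → ℝ) (D₁ D₂ : ℝ) (c : RandCode S T₁ T₂ M₁ M₂) :
    optDPSR M₁ M₂ P d₁ d₂ D₁ D₂ ≤ ((c.excessProb P d₁ d₂ D₁ D₂ : ℝ) : EReal) :=
  have ⟨c', hc'⟩ := c.exists_code_excessProb_le P d₁ d₂ D₁ D₂
  (optDPSR_le_code P d₁ d₂ D₁ D₂ c').trans (EReal.coe_le_coe_iff.2 hc')

end WeakDuality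

section DualPoint

variable {S T₁ T₂ : Type*}

theorem one_le_exp_sub_div_iff {j γ c : ℝ} (hc : 0 < c) :
    1 ≤ Real.exp (j - γ) / c ↔ Real.log c + γ ≤ j := by
  rw [one_le_div hc, ← Real.log_le_iff_le_exp hc, le_sub_iff_add_le]

/-- The credit given in the dual point to a source symbol with weights `a` and `b`. Any value up to
`min 1 (a + b)` is feasible; the average of `a` and `b` is what yields `improvement`. -/
noncomputable def weightProfile (a b : ℝ) : ℝ := if 1 ≤ a ∨ 1 ≤ b then 1 else (a + b) / 2

theorem weightProfile_le_one (a b : ℝ) : weightProfile a b ≤ 1 := by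
  unfold weightProfile
  split_ifs with h
  · rfl
  · rw [not_or, not_le, not_le] at h
    linarith

theorem weightProfile_le_add {a b : ℝ} (ha : 0 ≤ a) (hb : 0 ≤ b) : weightProfile a b ≤ a + b := by
  unfold weightProfile
  split_ifs with h
  · rcases h with h | h <;> linarith
  · linarith

theorem le_add_add_excessLoss {a b u : ℝ} (ha : 0 ≤ a) (hb : 0 ≤ b) (hu : u ≤ 1)
    (huab : u ≤ a + b) (d₁ : S → T₁ → ℝ) (d₂ : S → T₂ → ℝ) (D₁ D₂ : ℝ) (s : S) (t₁ : T₁)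
    (t₂ : T₂) :
    u ≤ a * (if d₁ s t₁ ≤ D₁ then 1 else 0) + b * (if d₂ s t₂ ≤ D₂ then 1 else 0) +
      excessLoss d₁ d₂ D₁ D₂ s t₁ t₂ := by
  simp only [excessLoss, ← not_le]
  by_cases h₁ : d₁ s t₁ ≤ D₁ <;> by_cases h₂ : d₂ s t₂ ≤ D₂ <;> simp [h₁, h₂] <;> linarith

/-- The dual point in which the source symbol `s` is credited `v s`, of which the reconstructions
`t₁` and `t₂` pay `α s t₁` and `β s t₂`. Each `y₁` and each pair `(y₁, y₂)` is charged a bound, `A`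
and `B` respectively, on the total payment of one reconstruction. -/
noncomputable def weightDualPoint (M₁ M₂ : ℕ) (v : S → ℝ) (α : S → T₁ → ℝ) (β : S → T₂ → ℝ)
    (A B : ℝ) : DualVars S T₁ T₂ M₁ M₂ where
  η₁ := v
  η₂ _ := -A
  η₃ _ _ := -B
  η₄ _ := 0
  lamA s x₂ _ y₂ t₁ _ := noiseless y₂ x₂ * -α s t₁
  lamB s _ _ _ _ t₂ := -β s t₂
  lamC s x₁ x₂ y₁ y₂ _ := noiseless y₂ x₂ * (noiseless y₁ x₁ * v s)
  μ s x₁ _ y₁ := noiseless y₁ x₁ * v s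
  δ₁ _ := v
  δ₂ s t₂ _ _ := -β s t₂
  δ₃ s t₁ _ := -α s t₁
  θ _ s _ t₂ _ := -β s t₂
  γ x₂ s t₁ _ y₂ := noiseless y₂ x₂ * -α s t₁

variable [Fintype S] {P v : S → ℝ} {d₁ : S → T₁ → ℝ} {d₂ : S → T₂ → ℝ} {D₁ D₂ : ℝ}

theorem weightDualPoint_objective (M₁ M₂ : ℕ) (v : S → ℝ) (α : S → T₁ → ℝ) (β : S → T₂ → ℝ)
    (A B : ℝ) :
    (weightDualPoint M₁ M₂ v α β A B).objective = ∑ s, v s - M₁ * A - M₁ * M₂ * B := by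
  simp only [DualVars.objective, weightDualPoint, Finset.sum_const, Finset.card_univ,
    Fintype.card_fin, nsmul_eq_mul]
  ring

theorem weightDualPoint_feasible (M₁ M₂ : ℕ) {α : S → T₁ → ℝ} {β : S → T₂ → ℝ} {A B : ℝ}
    (hα : ∀ s t₁, 0 ≤ α s t₁) (hβ : ∀ s t₂, 0 ≤ β s t₂)
    (hA : ∀ t₁, ∑ s, α s t₁ ≤ A) (hB : ∀ t₂, ∑ s, β s t₂ ≤ B)
    (hv : ∀ s t₁ t₂, v s ≤ α s t₁ + β s t₂ + P s * excessLoss d₁ d₂ D₁ D₂ s t₁ t₂) :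
    (weightDualPoint M₁ M₂ v α β A B).Feasible P d₁ d₂ D₁ D₂ where
  c1 _ _ := (sub_self _).le
  c2 _ t₁ := by simpa [weightDualPoint] using hA t₁
  c3 _ _ t₂ := by simpa [weightDualPoint] using hB t₂
  c4 s x₁ x₂ y₁ y₂ t₁ t₂ := by
    simp only [weightDualPoint, noiseless]
    split_ifs <;> linarith [hα s t₁, hβ s t₂, hv s t₁ t₂]
  c5 _ _ _ _ _ := by simp only [weightDualPoint, sum_noiseless_mul, neg_add_cancel, le_refl]
  c6 _ _ _ := by simp only [weightDualPoint, sum_noiseless_mul, neg_add_cancel, le_refl]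
  c7 _ _ _ _ _ := (neg_add_cancel _).le
  c8 _ _ _ _ := by simp only [weightDualPoint, sum_noiseless_mul, neg_add_cancel, le_refl]
  c9 _ _ _ _ _ _ := (neg_add_cancel _).le
  c10 _ _ _ _ _ _ := (neg_add_cancel _).le
  c11 _ := le_rfl

theorem sum_mul_weightProfile {M₁ M₂ : ℕ} (hM₁ : 0 < M₁) (hM₂ : 0 < M₂) (P j₁ j₂ : S → ℝ)
    (γ₁ γ₂ : ℝ) :
    ∑ s, P s * weightProfile (Real.exp (j₁ s - γ₁) / M₁) (Real.exp (j₂ s - γ₂) / (M₁ * M₂)) =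
      (∑ s, if Real.log M₁ + γ₁ ≤ j₁ s ∨ Real.log (M₁ * M₂) + γ₂ ≤ j₂ s then P s else 0) +
        improvement M₁ M₂ P j₁ j₂ γ₁ γ₂ := by
  rw [improvement, ← Finset.sum_add_distrib]
  refine Finset.sum_congr rfl fun s _ => ?_
  have m₁ : (0 : ℝ) < M₁ := Nat.cast_pos.2 hM₁
  have m₂ : (0 : ℝ) < M₂ := Nat.cast_pos.2 hM₂
  simp only [weightProfile, one_le_exp_sub_div_iff m₁, one_le_exp_sub_div_iff (mul_pos m₁ m₂),
    ← not_le, ← not_or]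
  split_ifs
  · ring
  · field_simp
    ring

theorem improvement_nonneg (M₁ M₂ : ℕ) (hP : ∀ s, 0 ≤ P s) (j₁ j₂ : S → ℝ) (γ₁ γ₂ : ℝ) :
    0 ≤ improvement M₁ M₂ P j₁ j₂ γ₁ γ₂ := by
  refine Finset.sum_nonneg fun s _ => mul_nonneg (div_nonneg (hP s) (by positivity))
    (mul_nonneg (by positivity) ?_)
  split_ifs
  exacts [zero_le_one, le_rfl]

theorem sum_mul_exp_sub_div_mul_le {j χ : S → ℝ} {c : ℝ} (hc : 0 ≤ c)
    (h : ∑ s, P s * (Real.exp (j s) * χ s) ≤ 1) (γ : ℝ) :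
    ∑ s, P s * (Real.exp (j s - γ) / c * χ s) ≤ Real.exp (-γ) / c := by
  calc ∑ s, P s * (Real.exp (j s - γ) / c * χ s)
      = Real.exp (-γ) / c * ∑ s, P s * (Real.exp (j s) * χ s) := by
        rw [Finset.mul_sum]
        refine Finset.sum_congr rfl fun s _ => ?_
        rw [sub_eq_add_neg, Real.exp_add]
        ring
    _ ≤ _ := mul_le_of_le_one_right (by positivity) h

theorem exists_feasible_objective_eq {M₁ M₂ : ℕ} (hM₁ : 0 < M₁) (hM₂ : 0 < M₂)
    (hP : ∀ s, 0 ≤ P s) {j₁ j₂ : S → ℝ}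
    (h₁ : ∀ t, ∑ s, P s * (Real.exp (j₁ s) * if d₁ s t ≤ D₁ then 1 else 0) ≤ 1)
    (h₂ : ∀ t, ∑ s, P s * (Real.exp (j₂ s) * if d₂ s t ≤ D₂ then 1 else 0) ≤ 1) (γ₁ γ₂ : ℝ) :
    ∃ F : DualVars S T₁ T₂ M₁ M₂, F.Feasible P d₁ d₂ D₁ D₂ ∧
      F.objective = baseBound M₁ M₂ P j₁ j₂ γ₁ γ₂ + improvement M₁ M₂ P j₁ j₂ γ₁ γ₂ := by
  have m₁ : (0 : ℝ) < M₁ := Nat.cast_pos.2 hM₁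
  have m₁₂ : (0 : ℝ) < M₁ * M₂ := mul_pos m₁ (Nat.cast_pos.2 hM₂)
  let a : S → ℝ := fun s => Real.exp (j₁ s - γ₁) / M₁
  let b : S → ℝ := fun s => Real.exp (j₂ s - γ₂) / (M₁ * M₂)
  have ha : ∀ s, 0 ≤ a s := fun s => by positivity
  have hb : ∀ s, 0 ≤ b s := fun s => by positivity
  have payment_nonneg {c : ℝ} (hc : 0 ≤ c) (s : S) (p : Prop) [Decidable p] :
      0 ≤ P s * (c * if p then 1 else 0) :=
    mul_nonneg (hP s) (mul_nonneg hc (by split_ifs <;> simp))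
  refine ⟨weightDualPoint M₁ M₂ (fun s => P s * weightProfile (a s) (b s))
    (fun s t₁ => P s * (a s * if d₁ s t₁ ≤ D₁ then 1 else 0))
    (fun s t₂ => P s * (b s * if d₂ s t₂ ≤ D₂ then 1 else 0))
    (Real.exp (-γ₁) / M₁) (Real.exp (-γ₂) / (M₁ * M₂)),
    weightDualPoint_feasible M₁ M₂ (fun s _ => payment_nonneg (ha s) s _)
      (fun s _ => payment_nonneg (hb s) s _)
      (fun t => sum_mul_exp_sub_div_mul_le m₁.le (h₁ t) γ₁)
      (fun t => sum_mul_exp_sub_div_mul_le m₁₂.le (h₂ t) γ₂) fun s t₁ t₂ => ?_, ?_⟩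
  · simp only [← mul_add]
    exact mul_le_mul_of_nonneg_left (le_add_add_excessLoss (ha s) (hb s)
      (weightProfile_le_one _ _) (weightProfile_le_add (ha s) (hb s)) ..) (hP s)
  · rw [weightDualPoint_objective, sum_mul_weightProfile hM₁ hM₂, baseBound,
      mul_div_cancel₀ _ m₁.ne', mul_div_cancel₀ _ m₁₂.ne']
    ring

end DualPoint

end SuccRef

theorem mainTheorem6_general {S T₁ T₂ : Type*} [Fintype S] [Fintype T₁] [Fintype T₂]
    (M₁ M₂ : ℕ) (hM₁ : 0 < M₁) (hM₂ : 0 < M₂)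
    (P : S → ℝ) (hP : P ∈ stdSimplex ℝ S)
    (d₁ : S → T₁ → ℝ) (d₂ : S → T₂ → ℝ) (D₁ D₂ : ℝ)
    (W₁ : S → T₁ → ℝ) (hW₁ : SuccRef.IsOptimalTestChannel P d₁ D₁ W₁)
    (hR₁ : DifferentiableAt ℝ (SuccRef.rateDistortion P d₁) D₁)
    (W₂ : S → T₂ → ℝ) (hW₂ : SuccRef.IsOptimalTestChannel P d₂ D₂ W₂)
    (hR₂ : DifferentiableAt ℝ (SuccRef.rateDistortion P d₂) D₂)
    (j₁ : S → ℝ) (hj₁ : j₁ = SuccRef.tiltedInfo P d₁ D₁ W₁)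
    (j₂ : S → ℝ) (hj₂ : j₂ = SuccRef.tiltedInfo P d₂ D₂ W₂) :
    (∀ c : SuccRef.Code S T₁ T₂ M₁ M₂,
      SuccRef.optDPSR M₁ M₂ P d₁ d₂ D₁ D₂ ≤ ((c.excessProb P d₁ d₂ D₁ D₂ : ℝ) : EReal)) ∧
    (∀ c : SuccRef.RandCode S T₁ T₂ M₁ M₂,
      SuccRef.optDPSR M₁ M₂ P d₁ d₂ D₁ D₂ ≤ ((c.excessProb P d₁ d₂ D₁ D₂ : ℝ) : EReal)) ∧
    (∀ γ₁ γ₂ : ℝ, ∃ F : SuccRef.DualVars S T₁ T₂ M₁ M₂, F.Feasible P d₁ d₂ D₁ D₂ ∧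
      F.objective = SuccRef.baseBound M₁ M₂ P j₁ j₂ γ₁ γ₂
        + SuccRef.improvement M₁ M₂ P j₁ j₂ γ₁ γ₂) ∧
    (⨆ (γ₁ : ℝ) (γ₂ : ℝ), ((SuccRef.baseBound M₁ M₂ P j₁ j₂ γ₁ γ₂
        + SuccRef.improvement M₁ M₂ P j₁ j₂ γ₁ γ₂ : ℝ) : EReal))
      ≤ SuccRef.optDPSR M₁ M₂ P d₁ d₂ D₁ D₂ ∧
    (∀ γ₁ γ₂ : ℝ, 0 ≤ SuccRef.improvement M₁ M₂ P j₁ j₂ γ₁ γ₂) := by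
  have feasible_point := SuccRef.exists_feasible_objective_eq hM₁ hM₂ hP.1
    (fun t => hj₁ ▸ hW₁.sum_exp_tiltedInfo_le_one hP hR₁ t)
    (fun t => hj₂ ▸ hW₂.sum_exp_tiltedInfo_le_one hP hR₂ t)
  refine ⟨SuccRef.optDPSR_le_code P d₁ d₂ D₁ D₂, SuccRef.optDPSR_le_randCode P d₁ d₂ D₁ D₂,
    feasible_point, iSup₂_le fun γ₁ γ₂ => ?_, SuccRef.improvement_nonneg M₁ M₂ hP.1 j₁ j₂⟩
  obtain ⟨F, hF, hobj⟩ := feasible_point γ₁ γ₂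
  exact hobj ▸ le_iSup₂_of_le F hF le_rfl

theorem mainTheorem6 {S T₁ T₂ : Type*} [Fintype S] [Fintype T₁] [Fintype T₂]
    (M₁ M₂ : ℕ) (hM₁ : 0 < M₁) (hM₂ : 0 < M₂)
    (P : S → ℝ) (hP : P ∈ stdSimplex ℝ S)
    (d₁ : S → T₁ → ℝ) (hd₁ : ∀ s t, 0 ≤ d₁ s t)
    (d₂ : S → T₂ → ℝ) (hd₂ : ∀ s t, 0 ≤ d₂ s t)
    (D₁ D₂ : ℝ) (hD₁ : 0 ≤ D₁) (hD₂ : 0 ≤ D₂)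
    (hSR : SuccRef.IsSuccessivelyRefinable P d₁ d₂ D₁ D₂)
    -- the tilted informations are defined: the infima are attained and the slopes exist
    (W₁ : S → T₁ → ℝ) (hW₁ : SuccRef.IsOptimalTestChannel P d₁ D₁ W₁)
    (hR₁ : DifferentiableAt ℝ (SuccRef.rateDistortion P d₁) D₁)
    (W₂ : S → T₂ → ℝ) (hW₂ : SuccRef.IsOptimalTestChannel P d₂ D₂ W₂)
    (hR₂ : DifferentiableAt ℝ (SuccRef.rateDistortion P d₂) D₂)
    (j₁ : S → ℝ) (hj₁ : j₁ = SuccRef.tiltedInfo P d₁ D₁ W₁)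
    (j₂ : S → ℝ) (hj₂ : j₂ = SuccRef.tiltedInfo P d₂ D₂ W₂) :
    -- the dual optimum is a lower bound for every code, deterministic or randomized
    (∀ c : SuccRef.Code S T₁ T₂ M₁ M₂,
      SuccRef.optDPSR M₁ M₂ P d₁ d₂ D₁ D₂ ≤ ((c.excessProb P d₁ d₂ D₁ D₂ : ℝ) : EReal)) ∧
    (∀ c : SuccRef.RandCode S T₁ T₂ M₁ M₂,
      SuccRef.optDPSR M₁ M₂ P d₁ d₂ D₁ D₂ ≤ ((c.excessProb P d₁ d₂ D₁ D₂ : ℝ) : EReal)) ∧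
    -- each member of the family of bounds is the value of a dual feasible point
    (∀ γ₁ γ₂ : ℝ, ∃ F : SuccRef.DualVars S T₁ T₂ M₁ M₂, F.Feasible P d₁ d₂ D₁ D₂ ∧
      F.objective = SuccRef.baseBound M₁ M₂ P j₁ j₂ γ₁ γ₂
        + SuccRef.improvement M₁ M₂ P j₁ j₂ γ₁ γ₂) ∧
    (⨆ (γ₁ : ℝ) (γ₂ : ℝ), ((SuccRef.baseBound M₁ M₂ P j₁ j₂ γ₁ γ₂
        + SuccRef.improvement M₁ M₂ P j₁ j₂ γ₁ γ₂ : ℝ) : EReal))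
      ≤ SuccRef.optDPSR M₁ M₂ P d₁ d₂ D₁ D₂ ∧
    -- the additional term is nonnegative
    (∀ γ₁ γ₂ : ℝ, 0 ≤ SuccRef.improvement M₁ M₂ P j₁ j₂ γ₁ γ₂) :=
  mainTheorem6_general M₁ M₂ hM₁ hM₂ P hP d₁ d₂ D₁ D₂ W₁ hW₁ hR₁ W₂ hW₂ hR₂ j₁ hj₁ j₂ hj₂
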